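/- Let $2\le k\le n$ be natural numbers. Then there exist a full discrete isothermic $k$-dimensional torus and a full semi-discrete isothermic $k$-dimensional torus (smooth in one direction, discrete in $k-1$ directions) in $\mathbb{R}^n$. Here the notions are as follows. *Full* means that the image lies in no $(n-1)$-dimensional affine subspace of $\mathbb{R}^n$. For points of $\mathbb{R}^n$ put $$\mathrm{cr}(y,y_1,y_{12},y_2)=\frac{|y-y_1|^2|y_{12}-y_2|^2+|y-y_2|^2|y_1-y_{12}|^2-|y-y_{12}|^2|y_1-y_2|^2}{2\,|y-y_2|^2|y_1-y_{12}|^2},$$ which for concircular points is their usual (real) cross ratio. The infinitesimal cross ratio of two curves $y(t),z(t)$ is $\lim_{h\to0}h^{-2}\,\mathrm{cr}(y(t),y(t+h),z(t+h),z(t))$. A *discrete isothermic net* is a map $p:\mathbb{Z}^d\to\mathbb{R}^n$ such that, for all $i\ne j$ and all $x\in\mathbb{Z}^d$, the elementary quadrilateral $p(x),\,p(x+e_i),\,p(x+e_i+e_j),\,p(x+e_j)$ has four distinct vertices lying on a circle, and such that in every two-dimensional coordinate subnet the cross ratios $\mathrm{cr}_1,\mathrm{cr}_2,\mathrm{cr}_3,\mathrm{cr}_4$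 of the four quadrilaterals around any vertex, in counterclockwise order, satisfy $\mathrm{cr}_1\mathrm{cr}_2^{-1}\mathrm{cr}_3\mathrm{cr}_4^{-1}=1$. It *closes up* if for each $i$ there is a period $L_i\ge3$ with $p(x+L_ie_i)=p(x)$ for all $x$, and any three successive vertices $p(x),p(x+e_i),p(x+2e_i)$ are distinct. A *discrete isothermic $k$-torus* is a discrete isothermic net $p:\mathbb{Z}^k\to\mathbb{R}^n$ that closes up. A *semi-discrete isothermic $k$-torus* is a map $f:\mathbb{R}\times\mathbb{Z}^{k-1}\to\mathbb{R}^n$ such that: each curve $t\mapsto f(t,x)$ is smooth with nowhere vanishing derivative; for each discrete direction $i$, corresponding points $f(t,x)$ and $f(t,x+e_i)$ of adjacent curves are distinct and there is a circle tangent to both curves at these points; on each coordinate subnet in $t$ and one discrete coordinate $s$ the infinitesimal cross ratios of adjacent curves exist and have the form $a(t)/b(s)$ with nowhere vanishing $a,b$; for each $t$ the map $f(t,\cdot)$ is a discrete isothermic net; $f(t+T,x)=f(t,x)$ for some $T>0$; and the nets $f(t,\cdot)$ close up with periods $L_1,\dots,L_{k-1}$ independent of $t$. -/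

import Mathlib

namespace IsothermicNet

/-- Euclidean space `ℝⁿ`. -/
abbrev E (n : ℕ) : Type := EuclideanSpace ℝ (Fin n)

/-- The point set `M` is full in `ℝⁿ`: it lies in no `(n-1)`-dimensional affine subspace. -/
def IsFull {n : ℕ} (M : Set (E n)) : Prop :=
  ∀ A : AffineSubspace ℝ (E n), Module.finrank ℝ A.direction + 1 = n → ¬ M ⊆ (A : Set (E n))

/-- The cross ratio `cr(y, y₁, y₁₂, y₂)` of points of `ℝⁿ`. The light cone formula
`(⟨Y,Y₁⟩⟨Y₁₂,Y₂⟩ + ⟨Y,Y₂⟩⟨Y₁,Y₁₂⟩ - ⟨Y,Y₁₂⟩⟨Y₁,Y₂⟩) / (2⟨Y,Y₂⟩⟨Y₁,Y₁₂⟩)`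
is written out with `⟨Y,Z⟩ = -2 |y - z|²` for the lifts `Y = (2y, 1-|y|², 1+|y|²)`.
For points of a plane `ℂ` it is the real part of
`(y - y₁)(y₁₂ - y₂) / ((y₁ - y₁₂)(y₂ - y))`, hence equal to it for concircular points. -/
noncomputable def cr {n : ℕ} (y y₁ y₁₂ y₂ : E n) : ℝ :=
  (dist y y₁ ^ 2 * dist y₁₂ y₂ ^ 2 + dist y y₂ ^ 2 * dist y₁ y₁₂ ^ 2
      - dist y y₁₂ ^ 2 * dist y₁ y₂ ^ 2) / (2 * dist y y₂ ^ 2 * dist y₁ y₁₂ ^ 2)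

/-- The two curves `y`, `z` have infinitesimal cross ratio `c` at the parameter `t`:
`c = lim_{h → 0} h⁻² cr(y(t), y(t+h), z(t+h), z(t))`, the limit existing. -/
def HasInfCr {n : ℕ} (y z : ℝ → E n) (t c : ℝ) : Prop :=
  Filter.Tendsto (fun h : ℝ => (h ^ 2)⁻¹ * cr (y t) (y (t + h)) (z (t + h)) (z t))
    (nhdsWithin 0 {0}ᶜ) (nhds c)

/-- There is a circle (with centre `c` and radius `r > 0`, in the plane `c + P`) that passes
through `y` with tangent direction `u` and through `z` with tangent direction `v`. -/
def HasCommonTangentCircle {n : ℕ} (y u z v : E n) : Prop :=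
  ∃ (c : E n) (r : ℝ) (P : Submodule ℝ (E n)), 0 < r ∧ Module.finrank ℝ P = 2 ∧
    (y - c ∈ P ∧ dist y c = r ∧ u ∈ P ∧ inner ℝ u (y - c) = 0) ∧
    (z - c ∈ P ∧ dist z c = r ∧ v ∈ P ∧ inner ℝ v (z - c) = 0)

/-- The `i`-th unit step in the lattice `ℤᵈ`. -/
def e {d : ℕ} (i : Fin d) : Fin d → ℤ := Pi.single i 1

section Discrete

variable {d n : ℕ} (p : (Fin d → ℤ) → E n)

/-- The elementary quadrilateral of `p` with lower left vertex `x` in the directions `i`, `j`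
has four distinct vertices, and these lie on a circle. -/
def IsCircularFace (i j : Fin d) (x : Fin d → ℤ) : Prop :=
  [p x, p (x + e i), p (x + e i + e j), p (x + e j)].Nodup ∧
    EuclideanGeometry.Concyclic ({p x, p (x + e i), p (x + e i + e j), p (x + e j)} : Set (E n))

/-- The cross ratio of the elementary quadrilateral of `p` with lower left vertex `x` in the
directions `i`, `j`. -/
noncomputable def faceCr (i j : Fin d) (x : Fin d → ℤ) : ℝ :=
  cr (p x) (p (x + e i)) (p (x + e i + e j)) (p (x + e j))

/-- `p` is a completely discrete isothermic net: in every coordinate `2`-subnet the elementary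
quadrilaterals are circular with four distinct vertices, and the cross ratios of the four
quadrilaterals around any vertex (the vertex `x + e i + e j`, counterclockwise) satisfy
`cr₁ cr₂⁻¹ cr₃ cr₄⁻¹ = 1`. -/
structure IsDiscreteIsothermicNet : Prop where
  circular : ∀ i j, i ≠ j → ∀ x, IsCircularFace p i j x
  factorizes : ∀ i j, i ≠ j → ∀ x,
    faceCr p i j x * (faceCr p i j (x + e i))⁻¹ *
      faceCr p i j (x + e i + e j) * (faceCr p i j (x + e j))⁻¹ = 1

/-- `p` closes up, with period `L i ≥ 3` in the `i`-th direction, and its coordinate polygons are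
regular: any three successive vertices are distinct, so that no polygon is traversed back and
forth. -/
structure IsDiscreteClosed (L : Fin d → ℕ) : Prop where
  three_le : ∀ i, 3 ≤ L i
  periodic : ∀ i x, p (x + (L i : ℤ) • e i) = p x
  regular : ∀ i x, [p x, p (x + e i), p (x + e i + e i)].Nodup

/-- `p` is a (completely) discrete isothermic torus. -/
def IsDiscreteIsothermicTorus : Prop :=
  IsDiscreteIsothermicNet p ∧ ∃ L : Fin d → ℕ, IsDiscreteClosed p L

end Discrete

section SemiDiscrete

variable {d n : ℕ} (f : ℝ → (Fin d → ℤ) → E n)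

/-- `f` is a semi-discrete isothermic net, smooth in one direction (the variable `t`) and discrete
in `d` directions.
* The coordinate curves are smooth and regular.
* The corresponding points of adjacent smooth curves are distinct and the curves have a common
  tangential circle there; on every semi-discrete coordinate `2`-subnet the infinitesimal cross
  ratios factorize as `a(t) / b(s)`, where `s` is the discrete coordinate.
* The completely discrete coordinate `2`-subnets are discrete isothermic. -/
structure IsSemiDiscreteIsothermicNet : Prop where
  smooth : ∀ x, ContDiff ℝ (⊤ : ℕ∞) (fun t => f t x)
  immersed : ∀ t x, deriv (fun τ => f τ x) t ≠ 0
  distinct : ∀ t i x, f t x ≠ f t (x + e i)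
  tangential : ∀ t i x, HasCommonTangentCircle
    (f t x) (deriv (fun τ => f τ x) t) (f t (x + e i)) (deriv (fun τ => f τ (x + e i)) t)
  factorizes : ∀ i x, ∃ (a : ℝ → ℝ) (b : ℤ → ℝ), (∀ t, a t ≠ 0) ∧ (∀ s, b s ≠ 0) ∧
    ∀ t s, HasInfCr (fun τ => f τ (Function.update x i s))
      (fun τ => f τ (Function.update x i s + e i)) t (a t / b s)
  discrete : ∀ t, IsDiscreteIsothermicNet (f t)

/-- `f` is a semi-discrete isothermic torus: moreover it closes up in the smooth direction (with
some period `T > 0`) and in all discrete directions. -/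
def IsSemiDiscreteIsothermicTorus : Prop :=
  IsSemiDiscreteIsothermicNet f ∧ (∃ T : ℝ, 0 < T ∧ ∀ t x, f (t + T) x = f t x) ∧
    ∃ L : Fin d → ℕ, ∀ t, IsDiscreteClosed (f t) L

end SemiDiscrete

end IsothermicNet

/-!
A net `p : ℤᵈ → ℝⁿ` whose edge in direction `i` depends on the `i`-th lattice coordinate only, with
edges in different directions orthogonal, has rectangles as faces. A rectangle with sides `a`, `b`
is inscribed in a circle and has cross ratio `-a²/b²`, so such a net is isothermic
(`isDiscreteIsothermicNet_of_orthogonal_edges`).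

*Discrete tori.* Given a surjection `σ : Fin n → Fin d`, split `ℝⁿ` into `d` orthogonal coordinate
subspaces, the `i`-th spanned by the coordinates `j` with `σ j = i`, and put a closed polygon into
each of them; the product of these polygons is a net as above. The polygons are inscribed in moment
curves `r ↦ (r ^ (j + 1))ⱼ` at the parameters `r = 1, …, n + 3`, so their vertices are distinct.
The product is full because a polynomial of degree at most `n` with `n + 3` zeros vanishes
(`eq_zero_of_inner_momentTorus_sub`).

Where `σ⁻¹(i)` is a single coordinate, the polygon is inscribed in a line, a circle through `∞`
in the Möbius geometry to which isothermic nets belong. For `d = n` no dimensions are left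
for anything else in a product, and no torus of dimension `n` can be immersed in `ℝⁿ`.

*Semi-discrete tori.* The net above lies where the coordinate `y₀` is positive, so it can be rotated
about the hyperplane `y₀ = 0`: writing `rotate t` for the isometric embedding
`y ↦ (y₀ sin t, y₀ cos t, y₁, …)`, take `f t x = rotate t (p x)`. Each `f t` is congruent to `p`.
The orbits of two points `a ≠ b` are circles, and at corresponding points their tangents are
parallel and orthogonal to the segment between the points, so the circle over this segment as
diameter in the plane of the segment and the tangents touches both. By
`dist_rotate_sq` the quadrilateral spanned by the parameters `t` and `t + h` has cross ratio
`-2 a₀ b₀ (1 - cos h) / |a - b|²`, and so the infinitesimal cross ratio is `-a₀ b₀ / |a - b|²`,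
independent of `t`.
-/

namespace IsothermicNet

open Filter Topology

/-! ### Rectangles -/

section Rectangle

variable {n : ℕ} {y a b : E n}

lemma rectangle_nodup (ha : a ≠ 0) (hb : b ≠ 0) (hab : inner ℝ a b = 0) :
    [y, y + a, y + a + b, y + b].Nodup := by
  have h1 : a + b ≠ 0 := fun h => by
    have h2 : inner ℝ a (a + b) = 0 := by rw [h, inner_zero_right]
    rw [inner_add_right, hab, add_zero] at h2
    exact ha (inner_self_eq_zero.1 h2)
  have h3 : a ≠ b := fun h => by
    subst h
    exact ha (inner_self_eq_zero.1 hab)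
  simp [add_assoc, ha, hb, h1, h3]

lemma rectangle_concyclic (hab : inner ℝ a b = 0) :
    EuclideanGeometry.Concyclic ({y, y + a, y + a + b, y + b} : Set (E n)) := by
  constructor
  · -- the diagonals of a rectangle have the same midpoint and the same length
    have hn : ‖a - b‖ = ‖a + b‖ := by
      rw [← sq_eq_sq₀ (norm_nonneg _) (norm_nonneg _), norm_sub_sq_real, norm_add_sq_real, hab]
      ring
    refine ⟨y + (2⁻¹ : ℝ) • (a + b), ‖(2⁻¹ : ℝ) • (a + b)‖, ?_⟩
    rintro z (rfl | rfl | rfl | rfl)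
    · simp
    · have : y + a - (y + (2⁻¹ : ℝ) • (a + b)) = (2⁻¹ : ℝ) • (a - b) := by module
      rw [dist_eq_norm, this, norm_smul, norm_smul, hn]
    · have : y + a + b - (y + (2⁻¹ : ℝ) • (a + b)) = (2⁻¹ : ℝ) • (a + b) := by module
      rw [dist_eq_norm, this]
    · have : y + b - (y + (2⁻¹ : ℝ) • (a + b)) = -((2⁻¹ : ℝ) • (a - b)) := by module
      rw [dist_eq_norm, this, norm_neg, norm_smul, norm_smul, hn]
  · have hle : vectorSpan ℝ ({y, y + a, y + a + b, y + b} : Set (E n)) ≤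
        Submodule.span ℝ {a, b} := by
      rw [vectorSpan_eq_span_vsub_set_right ℝ (Set.mem_insert y _), Submodule.span_le]
      have h1 : a ∈ Submodule.span ℝ {a, b} := Submodule.subset_span (by simp)
      have h2 : b ∈ Submodule.span ℝ {a, b} := Submodule.subset_span (by simp)
      rintro _ ⟨z, (rfl | rfl | rfl | rfl), rfl⟩
      · simp
      · simpa using h1
      · simpa [add_assoc] using add_mem h1 h2
      · simpa using h2
    refine (Submodule.rank_mono hle).trans ((rank_span_le _).trans ?_)
    exact (Cardinal.mk_insert_le).trans (by rw [Cardinal.mk_singleton, one_add_one_eq_two])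

lemma rectangle_cr (hb : b ≠ 0) (hab : inner ℝ a b = 0) :
    cr y (y + a) (y + a + b) (y + b) = -(‖a‖ ^ 2 / ‖b‖ ^ 2) := by
  have hs : ‖a + b‖ ^ 2 = ‖a‖ ^ 2 + ‖b‖ ^ 2 := by rw [norm_add_sq_real, hab]; ring
  have hd : ‖a - b‖ ^ 2 = ‖a‖ ^ 2 + ‖b‖ ^ 2 := by rw [norm_sub_sq_real, hab]; ring
  have h1 : dist y (y + a) = ‖a‖ := by simp
  have h2 : dist (y + a + b) (y + b) = ‖a‖ := by
    rw [dist_eq_norm]; congr 1; abel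
  have h3 : dist y (y + b) = ‖b‖ := by simp
  have h4 : dist (y + a) (y + a + b) = ‖b‖ := by simp
  have h5 : dist y (y + a + b) = ‖a + b‖ := by simp [add_assoc]
  have h6 : dist (y + a) (y + b) = ‖a - b‖ := by
    rw [dist_eq_norm]; congr 1; abel
  have hb' : ‖b‖ ≠ 0 := norm_ne_zero_iff.2 hb
  rw [cr, h1, h2, h3, h4, h5, h6, hs, hd]
  field_simp
  ring

end Rectangle

lemma isDiscreteIsothermicNet_of_orthogonal_edges {d n : ℕ} {p : (Fin d → ℤ) → E n}
    (u : Fin d → ℤ → E n) (hp : ∀ i x, p (x + e i) = p x + u i (x i))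
    (h0 : ∀ i s, u i s ≠ 0) (horth : ∀ i j, i ≠ j → ∀ s t, inner ℝ (u i s) (u j t) = 0) :
    IsDiscreteIsothermicNet p := by
  have hsame : ∀ (i : Fin d) (x : Fin d → ℤ), (x + e i) i = x i + 1 := fun i x => by simp [e]
  have hne : ∀ (i j : Fin d) (x : Fin d → ℤ), i ≠ j → (x + e i) j = x j := fun i j x hij => by
    simp [e, hij.symm]
  have hdiag : ∀ i j, i ≠ j → ∀ x, p (x + e i + e j) = p x + u i (x i) + u j (x j) :=
    fun i j hij x => by rw [hp j, hne i j x hij, hp i]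
  have hcr : ∀ i j, i ≠ j → ∀ x, faceCr p i j x = -(‖u i (x i)‖ ^ 2 / ‖u j (x j)‖ ^ 2) :=
    fun i j hij x => by
      rw [faceCr, hdiag i j hij, hp i, hp j,
        rectangle_cr (h0 _ _) (horth i j hij _ _)]
  refine ⟨fun i j hij x => ?_, fun i j hij x => ?_⟩
  · rw [IsCircularFace, hdiag i j hij, hp i, hp j]
    exact ⟨rectangle_nodup (h0 _ _) (h0 _ _) (horth i j hij _ _),
      rectangle_concyclic (horth i j hij _ _)⟩
  · simp only [hcr i j hij, hsame, hne i j _ hij, hne j i _ hij.symm]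
    have hu : ∀ i s, ‖u i s‖ ≠ 0 := fun i s => norm_ne_zero_iff.2 (h0 i s)
    have h1 := hu i (x i)
    have h2 := hu i (x i + 1)
    have h3 := hu j (x j)
    have h4 := hu j (x j + 1)
    field_simp

/-! ### Fullness -/

lemma isFull_of_inner_sub_eq_zero {n : ℕ} {M : Set (E n)}
    (h : ∀ v : E n, (∀ y ∈ M, ∀ z ∈ M, inner ℝ v (y - z) = 0) → v = 0) : IsFull M := by
  intro A hA hM
  have hbot : A.directionᗮ = ⊥ := by
    refine (Submodule.eq_bot_iff _).2 fun v hv => h v fun y hy z hz => ?_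
    exact (Submodule.mem_orthogonal' _ _).1 hv _ (AffineSubspace.vsub_mem_direction (hM hy) (hM hz))
  have htop : A.direction = ⊤ := Submodule.orthogonal_eq_bot_iff.1 hbot
  rw [htop, finrank_top, finrank_euclideanSpace_fin] at hA
  omega

/-! ### Products of closed polygons -/

section MomentTorus

variable {n d : ℕ} (σ : Fin n → Fin d)

/-- The parameter at which the `s`-th vertex of a closed polygon with `n + 3` vertices is taken on
the moment curve: it runs through `1, …, n + 3` periodically. -/
noncomputable def node (n : ℕ) (s : ℤ) : ℝ := ((s % ((n : ℤ) + 3) + 1 : ℤ) : ℝ)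

lemma node_pos (s : ℤ) : 0 < node n s := by
  have := Int.emod_nonneg s (show (n : ℤ) + 3 ≠ 0 by omega)
  exact Int.cast_pos.2 (show 0 < s % ((n : ℤ) + 3) + 1 by omega)

lemma node_add_period (s : ℤ) : node n (s + ((n : ℤ) + 3)) = node n s := by
  simp [node]

lemma node_add_ne {c : ℤ} (h0 : 0 < c) (h3 : c < 3) (s : ℤ) : node n (s + c) ≠ node n s := by
  intro h
  have h1 : (s + c) % ((n : ℤ) + 3) = s % ((n : ℤ) + 3) := by
    simpa [node] using h
  have h2 : (n : ℤ) + 3 ∣ s + c - s := Int.ModEq.dvd (Eq.symm h1)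
  rw [add_sub_cancel_left] at h2
  have := Int.le_of_dvd h0 h2
  omega

lemma node_natCast {r : ℕ} (hr : r < n + 3) : node n r = r + 1 := by
  have : (r : ℤ) % ((n : ℤ) + 3) = r := Int.emod_eq_of_lt (by omega) (by omega)
  simp [node, this]

/-- The product of `d` closed polygons, the `i`-th of them in the coordinate subspace of the `j`
with `σ j = i`, where it is inscribed in the moment curve with coordinates `r ^ (j + 1)`. -/
noncomputable def momentTorus (x : Fin d → ℤ) : E n :=
  WithLp.toLp 2 fun j => node n (x (σ j)) ^ (j.val + 1)

lemma momentTorus_apply (x : Fin d → ℤ) (j : Fin n) :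
    momentTorus σ x j = node n (x (σ j)) ^ (j.val + 1) := rfl

lemma momentTorus_pos (x : Fin d → ℤ) (j : Fin n) : 0 < momentTorus σ x j :=
  pow_pos (node_pos _) _

/-- The edge of `momentTorus σ` in direction `i` from the `i`-th lattice coordinate `s`
to `s + 1`. -/
noncomputable def momentEdge (i : Fin d) (s : ℤ) : E n :=
  WithLp.toLp 2 fun j =>
    if σ j = i then node n (s + 1) ^ (j.val + 1) - node n s ^ (j.val + 1) else 0

lemma momentTorus_add_e (i : Fin d) (x : Fin d → ℤ) :
    momentTorus σ (x + e i) = momentTorus σ x + momentEdge σ i (x i) := by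
  ext j
  by_cases h : σ j = i
  · simp [momentTorus, momentEdge, e, h]
  · simp [momentTorus, momentEdge, e, h]

lemma momentEdge_orthogonal {i j : Fin d} (hij : i ≠ j) (s t : ℤ) :
    inner ℝ (momentEdge σ i s) (momentEdge σ j t) = 0 := by
  rw [PiLp.inner_apply]
  refine Finset.sum_eq_zero fun l _ => ?_
  by_cases h : σ l = i
  · have : σ l ≠ j := fun h' => hij (h.symm.trans h')
    simp [momentEdge, this]
  · simp [momentEdge, h]

lemma node_pow_add_ne {c : ℤ} (h0 : 0 < c) (h3 : c < 3) (s : ℤ) (j : ℕ) :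
    node n (s + c) ^ (j + 1) ≠ node n s ^ (j + 1) := fun h =>
  node_add_ne h0 h3 s <| (pow_left_inj₀ (node_pos _).le (node_pos _).le j.succ_ne_zero).1 h

lemma momentEdge_ne_zero {σ : Fin n → Fin d} (hσ : Function.Surjective σ) (i : Fin d) (s : ℤ) :
    momentEdge σ i s ≠ 0 := by
  obtain ⟨j, rfl⟩ := hσ i
  intro h
  have := congrArg (fun v : E n => v j) h
  simp only [momentEdge, if_true, PiLp.zero_apply] at this
  exact node_pow_add_ne one_pos (by norm_num) s j (sub_eq_zero.1 this)

lemma momentTorus_add_e_ne {σ : Fin n → Fin d} (hσ : Function.Surjective σ) (i : Fin d)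
    (x : Fin d → ℤ) : momentTorus σ x ≠ momentTorus σ (x + e i) := fun h =>
  momentEdge_ne_zero hσ i (x i) (left_eq_add.1 (h.trans (momentTorus_add_e σ i x)))

lemma isDiscreteClosed_momentTorus {σ : Fin n → Fin d} (hσ : Function.Surjective σ) :
    IsDiscreteClosed (momentTorus σ) (fun _ => n + 3) := by
  refine ⟨fun _ => by omega, fun i x => ?_, fun i x => ?_⟩
  · ext j
    by_cases h : σ j = i
    · simp only [momentTorus_apply, e, h, Pi.add_apply, Pi.smul_apply, Pi.single_eq_same,
        smul_eq_mul, mul_one]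
      rw [Nat.cast_add, Nat.cast_ofNat, node_add_period]
    · simp [momentTorus_apply, e, h]
  · have h2 : momentTorus σ x ≠ momentTorus σ (x + e i + e i) := by
      obtain ⟨j, rfl⟩ := hσ i
      intro h
      have := congrArg (fun v : E n => v j) h
      simp only [momentTorus_apply, e, Pi.add_apply, Pi.single_eq_same, add_assoc,
        one_add_one_eq_two] at this
      exact node_pow_add_ne two_pos (by norm_num) (x (σ j)) j this.symm
    simp [momentTorus_add_e_ne hσ i x, momentTorus_add_e_ne hσ i (x + e i), h2]

lemma IsDiscreteClosed.comp {m : ℕ} {p : (Fin d → ℤ) → E n} {L : Fin d → ℕ}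
    (hp : IsDiscreteClosed p L) {R : E n → E m} (hR : Function.Injective R) :
    IsDiscreteClosed (fun x => R (p x)) L :=
  ⟨hp.three_le, fun i x => congrArg R (hp.periodic i x),
    fun i x => by simpa using (hp.regular i x).map hR⟩

lemma isDiscreteIsothermicNet_comp_momentTorus {m : ℕ} {σ : Fin n → Fin d}
    (hσ : Function.Surjective σ) (R : E n →ₗᵢ[ℝ] E m) :
    IsDiscreteIsothermicNet (fun x => R (momentTorus σ x)) := by
  refine isDiscreteIsothermicNet_of_orthogonal_edges (fun i s => R (momentEdge σ i s))
    (fun i x => ?_) (fun i s => ?_) (fun i j hij s t => ?_)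
  · simp only [momentTorus_add_e, map_add]
  · exact (map_ne_zero_iff R R.injective).2 (momentEdge_ne_zero hσ i s)
  · rw [R.inner_map_map, momentEdge_orthogonal σ hij]

/-- A linear form that is constant on `momentTorus σ` vanishes. Along the `i`-th polygon its value
is a polynomial in the parameter of the moment curve, and this polynomial takes the same value at
more points than its degree. -/
lemma eq_zero_of_inner_momentTorus_sub {v : E n}
    (h : ∀ x x', inner ℝ v (momentTorus σ x - momentTorus σ x') = 0) : v = 0 := by
  ext j
  set P : Polynomial ℝ := ∑ l with σ l = σ j,
    Polynomial.C (v l) * (Polynomial.X ^ (l.val + 1) - 1) with hP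
  have hdeg : P.natDegree ≤ n := by
    refine Polynomial.natDegree_sum_le_of_forall_le _ _ fun l _ => ?_
    refine (Polynomial.natDegree_C_mul_le _ _).trans ?_
    refine (Polynomial.natDegree_sub_le _ _).trans ?_
    rw [Polynomial.natDegree_X_pow, Polynomial.natDegree_one]
    have := l.isLt
    omega
  have heval : ∀ r : Fin (n + 3), P.eval ((r : ℝ) + 1) = 0 := by
    intro r
    rw [← h (Function.update 0 (σ j) (r.val : ℤ)) 0, PiLp.inner_apply, hP,
      Polynomial.eval_finsetSum, Finset.sum_filter]
    refine Finset.sum_congr rfl fun l _ => ?_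
    have h0 : node n 0 = 1 := by simpa using node_natCast (n := n) (r := 0) (by omega)
    by_cases hl : σ l = σ j
    · simp [momentTorus_apply, hl, node_natCast r.isLt, h0, mul_comm]
    · simp [momentTorus_apply, hl]
  have hP0 : P = 0 := Polynomial.eq_zero_of_natDegree_lt_card_of_eval_eq_zero P
    (f := fun r : Fin (n + 3) => (r : ℝ) + 1)
    (fun r s hrs => Fin.ext (by simpa using hrs)) heval (by rw [Fintype.card_fin]; omega)
  have hc : P.coeff (j.val + 1) = v j := by
    rw [hP, Polynomial.finsetSum_coeff, Finset.sum_eq_single_of_mem j (by simp)]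
    · simp [Polynomial.coeff_one]
    · intro l _ hl
      have : j.val ≠ l.val := fun h => hl (Fin.ext h.symm)
      simp [Polynomial.coeff_one, Polynomial.coeff_X_pow, this]
  rw [← hc, hP0]
  simp

end MomentTorus

/-! ### Rotation about a coordinate hyperplane -/

section Rotation

variable {m : ℕ}

/-- The isometric embedding `y ↦ (y₀ sin t, y₀ cos t, y₁, …, yₘ)`. Its image is the image of
`y ↦ (0, y₀, y₁, …, yₘ)` under the rotation by the angle `t` in the plane of the
first two coordinates. -/
noncomputable def rotate (t : ℝ) : E (m + 1) →ₗᵢ[ℝ] E (m + 2) :=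
  LinearMap.isometryOfInner
    { toFun := fun q => WithLp.toLp 2
        (Fin.cons (Real.sin t * q 0) (Fin.cons (Real.cos t * q 0) fun j : Fin m => q j.succ))
      map_add' := fun q r => by
        ext j
        refine Fin.cases ?_ (Fin.cases ?_ fun l => ?_) j <;> simp [mul_add]
      map_smul' := fun c q => by
        ext j
        refine Fin.cases ?_ (Fin.cases ?_ fun l => ?_) j <;> simp [mul_left_comm] }
    (fun q r => by
      simp only [PiLp.inner_apply, LinearMap.coe_mk, AddHom.coe_mk, Fin.sum_univ_succ,
        Fin.cons_zero, Fin.cons_succ, RCLike.inner_apply, conj_trivial]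
      linear_combination (q 0 * r 0) * Real.sin_sq_add_cos_sq t)

lemma rotate_zero (t : ℝ) (q : E (m + 1)) : rotate t q 0 = Real.sin t * q 0 := rfl

lemma rotate_one (t : ℝ) (q : E (m + 1)) : rotate t q (Fin.succ 0) = Real.cos t * q 0 := rfl

lemma rotate_succ_succ (t : ℝ) (q : E (m + 1)) (j : Fin m) :
    rotate t q j.succ.succ = q j.succ := rfl

/-- The unit tangent at the parameter `t` of the circle `τ ↦ rotate τ q`, where `0 < q 0`. -/
noncomputable def tangent (m : ℕ) (t : ℝ) : E (m + 2) :=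
  WithLp.toLp 2 (Fin.cons (Real.cos t) (Fin.cons (-Real.sin t) 0))

lemma tangent_ne_zero (t : ℝ) : tangent m t ≠ 0 := by
  intro h
  have h0 : Real.cos t = 0 := congrArg (fun v : E (m + 2) => v 0) h
  have h1 : -Real.sin t = 0 := congrArg (fun v : E (m + 2) => v (Fin.succ 0)) h
  have := Real.sin_sq_add_cos_sq t
  simp [h0, neg_eq_zero.1 h1] at this

lemma inner_tangent_rotate (t : ℝ) (q : E (m + 1)) : inner ℝ (tangent m t) (rotate t q) = 0 := by
  rw [PiLp.inner_apply, Fin.sum_univ_succ, Fin.sum_univ_succ, rotate_zero, rotate_one]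
  simp [tangent]
  ring

lemma hasDerivAt_rotate (q : E (m + 1)) (t : ℝ) :
    HasDerivAt (fun τ => rotate τ q) (q 0 • tangent m t) t := by
  have h : HasDerivAt (fun τ => WithLp.ofLp (rotate τ q)) (WithLp.ofLp (q 0 • tangent m t)) t := by
    refine hasDerivAt_pi.2 fun j => ?_
    refine Fin.cases ?_ (Fin.cases ?_ fun l => ?_) j
    · exact ((Real.hasDerivAt_sin t).mul_const (q 0)).congr_deriv (mul_comm _ _)
    · exact ((Real.hasDerivAt_cos t).mul_const (q 0)).congr_deriv (mul_comm _ _)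
    · exact (hasDerivAt_const t (q l.succ)).congr_deriv (mul_zero _).symm
  exact (PiLp.hasFDerivAt_toLp (𝕜 := ℝ) 2 _).comp_hasDerivAt t h

lemma contDiff_rotate (q : E (m + 1)) : ContDiff ℝ (⊤ : ℕ∞) (fun τ => rotate τ q) := by
  refine contDiff_euclidean.2 fun j => ?_
  refine Fin.cases ?_ (Fin.cases ?_ fun l => ?_) j
  · exact Real.contDiff_sin.mul contDiff_const
  · exact Real.contDiff_cos.mul contDiff_const
  · exact contDiff_const

lemma dist_rotate_sq (s t : ℝ) (a b : E (m + 1)) :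
    dist (rotate s a) (rotate t b) ^ 2 =
      dist a b ^ 2 + 2 * (a 0 * b 0) * (1 - Real.cos (s - t)) := by
  rw [EuclideanSpace.dist_sq_eq, EuclideanSpace.dist_sq_eq, Fin.sum_univ_succ, Fin.sum_univ_succ,
    Fin.sum_univ_succ (n := m)]
  simp only [rotate_zero, rotate_one, rotate_succ_succ, Real.dist_eq, sq_abs, Real.cos_sub]
  linear_combination (a 0) ^ 2 * Real.sin_sq_add_cos_sq s + (b 0) ^ 2 * Real.sin_sq_add_cos_sq t

lemma cr_rotate {a b : E (m + 1)} (hab : a ≠ b) (t h : ℝ) :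
    cr (rotate t a) (rotate (t + h) a) (rotate (t + h) b) (rotate t b) =
      -(2 * (a 0 * b 0) * (1 - Real.cos h) / dist a b ^ 2) := by
  have hd : dist a b ≠ 0 := dist_ne_zero.2 hab
  simp only [cr, dist_rotate_sq, sub_self, Real.cos_zero, mul_zero, add_zero, dist_self,
    sub_add_cancel_left, add_sub_cancel_left, Real.cos_neg, zero_pow two_ne_zero, zero_add]
  field_simp
  ring

lemma tendsto_one_sub_cos_div_sq :
    Tendsto (fun h : ℝ => (1 - Real.cos h) / h ^ 2) (𝓝[≠] 0) (𝓝 (1 / 2)) := by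
  have h1 : Tendsto (fun h : ℝ => Real.sinc (h / 2) ^ 2 / 2) (𝓝 0) (𝓝 (1 / 2)) := by
    have : Continuous fun h : ℝ => Real.sinc (h / 2) ^ 2 / 2 :=
      ((Real.continuous_sinc.comp (continuous_id.div_const 2)).pow 2).div_const 2
    simpa using this.tendsto 0
  refine (h1.mono_left nhdsWithin_le_nhds).congr' ?_
  filter_upwards [self_mem_nhdsWithin] with h hh
  have hh : h ≠ 0 := hh
  have hc : Real.cos h = 1 - 2 * Real.sin (h / 2) ^ 2 := by
    have h2 := Real.cos_two_mul' (h / 2)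
    have h3 := Real.sin_sq_add_cos_sq (h / 2)
    rw [mul_div_cancel₀ h two_ne_zero] at h2
    linarith
  rw [Real.sinc_of_ne_zero (div_ne_zero hh two_ne_zero), hc]
  field_simp
  ring

lemma hasInfCr_rotate {a b : E (m + 1)} (hab : a ≠ b) (t : ℝ) :
    HasInfCr (fun τ => rotate τ a) (fun τ => rotate τ b) t (-(a 0 * b 0 / dist a b ^ 2)) := by
  have h := tendsto_one_sub_cos_div_sq.const_mul (-(2 * (a 0 * b 0) / dist a b ^ 2))
  rw [HasInfCr]
  convert h using 2 with τ
  · rw [cr_rotate hab]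
    ring
  · ring

/-- The circle with the segment from `rotate t a` to `rotate t b` as diameter, in the plane spanned
by this segment and `tangent m t`, touches both orbits. -/
lemma hasCommonTangentCircle_rotate {a b : E (m + 1)} (hab : a ≠ b) (t : ℝ) (u v : ℝ) :
    HasCommonTangentCircle (rotate t a) (u • tangent m t) (rotate t b) (v • tangent m t) := by
  have hw : rotate t (a - b) ≠ 0 := by
    simpa [sub_eq_zero] using hab
  have horth := inner_tangent_rotate t (a - b)
  have hya : rotate t a - rotate t ((2⁻¹ : ℝ) • (a + b)) = (2⁻¹ : ℝ) • rotate t (a - b) := by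
    rw [← map_sub, ← map_smul]; congr 1; module
  have hyb : rotate t b - rotate t ((2⁻¹ : ℝ) • (a + b)) = -((2⁻¹ : ℝ) • rotate t (a - b)) := by
    rw [← map_sub, ← map_smul, ← map_neg]; congr 1; module
  have hmw : rotate t (a - b) ∈ Submodule.span ℝ {tangent m t, rotate t (a - b)} :=
    Submodule.subset_span (by simp)
  have hmt : tangent m t ∈ Submodule.span ℝ {tangent m t, rotate t (a - b)} :=
    Submodule.subset_span (by simp)
  refine ⟨rotate t ((2⁻¹ : ℝ) • (a + b)), ‖(2⁻¹ : ℝ) • rotate t (a - b)‖,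
    Submodule.span ℝ {tangent m t, rotate t (a - b)}, ?_, ?_, ⟨?_, ?_, ?_, ?_⟩, ⟨?_, ?_, ?_, ?_⟩⟩
  · exact norm_pos_iff.2 (smul_ne_zero (by norm_num) hw)
  · have hli : LinearIndependent ℝ ![tangent m t, rotate t (a - b)] := by
      refine linearIndependent_of_ne_zero_of_inner_eq_zero ?_ ?_
      · intro i
        fin_cases i
        · exact tangent_ne_zero t
        · exact hw
      · intro i j hij
        fin_cases i <;> fin_cases j <;> simp_all [real_inner_comm]
    have := finrank_span_eq_card hli
    rwa [Matrix.range_cons, Matrix.range_cons, Matrix.range_empty, Set.union_empty,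
      Set.singleton_union, Fintype.card_fin] at this
  · rw [hya]; exact Submodule.smul_mem _ _ hmw
  · rw [dist_eq_norm, hya]
  · exact Submodule.smul_mem _ _ hmt
  · rw [hya, inner_smul_left, inner_smul_right, horth, mul_zero, mul_zero]
  · rw [hyb]; exact neg_mem (Submodule.smul_mem _ _ hmw)
  · rw [dist_eq_norm, hyb, norm_neg]
  · exact Submodule.smul_mem _ _ hmt
  · rw [hyb, inner_neg_right, inner_smul_left, inner_smul_right, horth, mul_zero, mul_zero,
      neg_zero]

end Rotation

/-! ### The rotated tori -/

section RotatedTorus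

variable {d m : ℕ} {σ : Fin (m + 1) → Fin d}

lemma isSemiDiscreteIsothermicTorus_rotate (hσ : Function.Surjective σ) :
    IsSemiDiscreteIsothermicTorus (fun t x => rotate t (momentTorus σ x)) := by
  have hd : ∀ x t, deriv (fun τ => rotate τ (momentTorus σ x)) t =
      momentTorus σ x 0 • tangent m t := fun x t => (hasDerivAt_rotate _ t).deriv
  have hne := momentTorus_add_e_ne hσ
  refine ⟨⟨fun x => contDiff_rotate _, fun t x => ?_, fun t i x => ?_, fun t i x => ?_,
    fun i x => ?_, fun t => isDiscreteIsothermicNet_comp_momentTorus hσ _⟩,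
    ⟨2 * Real.pi, by positivity, fun t x => ?_⟩, fun _ => m + 1 + 3,
    fun t => (isDiscreteClosed_momentTorus hσ).comp (rotate t).injective⟩
  · rw [hd]
    exact smul_ne_zero (momentTorus_pos σ x 0).ne' (tangent_ne_zero t)
  · exact (rotate t).injective.ne (hne i x)
  · rw [hd, hd]
    exact hasCommonTangentCircle_rotate (hne i x) t _ _
  · refine ⟨fun _ => 1, fun s =>
      -(dist (momentTorus σ (Function.update x i s))
            (momentTorus σ (Function.update x i s + e i)) ^ 2 /
        (momentTorus σ (Function.update x i s) 0 *
            momentTorus σ (Function.update x i s + e i) 0)),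
      fun _ => one_ne_zero, fun s => ?_, fun t s => ?_⟩
    · exact neg_ne_zero.2 (div_ne_zero (pow_ne_zero _ (dist_ne_zero.2 (hne _ _)))
        (mul_pos (momentTorus_pos _ _ _) (momentTorus_pos _ _ _)).ne')
    · rw [div_neg, one_div_div]
      exact hasInfCr_rotate (hne _ _) t
  · ext j
    refine Fin.cases ?_ (Fin.cases ?_ fun l => ?_) j <;>
      simp only [rotate_zero, rotate_one, rotate_succ_succ, Real.sin_add_two_pi,
        Real.cos_add_two_pi]

lemma isFull_rotate : IsFull {y | ∃ t x, rotate t (momentTorus σ x) = y} := by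
  refine isFull_of_inner_sub_eq_zero fun v hv => ?_
  have hv' : ∀ s x t x', inner ℝ v (rotate s (momentTorus σ x) - rotate t (momentTorus σ x')) = 0 :=
    fun s x t x' => hv _ ⟨s, x, rfl⟩ _ ⟨t, x', rfl⟩
  -- the points at the angles `π / 2` and `-π / 2` differ in the first coordinate only
  have h0 : v 0 = 0 := by
    have h := hv' (Real.pi / 2) 0 (-(Real.pi / 2)) 0
    rw [PiLp.inner_apply, Fin.sum_univ_succ, Fin.sum_univ_succ] at h
    simp only [PiLp.sub_apply, rotate_zero, rotate_one, rotate_succ_succ] at h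
    simpa [(momentTorus_pos σ 0 0).ne'] using h
  -- at the angle `0` the original torus appears in the other coordinates
  have h1 : (WithLp.toLp 2 fun j => v j.succ : E (m + 1)) = 0 := by
    refine eq_zero_of_inner_momentTorus_sub σ fun x x' => ?_
    have h := hv' 0 x 0 x'
    rw [PiLp.inner_apply, Fin.sum_univ_succ, Fin.sum_univ_succ] at h
    simp only [PiLp.sub_apply, rotate_zero, rotate_one, rotate_succ_succ, h0] at h
    rw [PiLp.inner_apply, Fin.sum_univ_succ]
    simpa using h
  ext j
  refine Fin.cases h0 (fun l => ?_) j
  exact congrArg (fun w : E (m + 1) => w l) h1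

end RotatedTorus

lemma exists_surjective_fin {k n : ℕ} (hk : 0 < k) (hkn : k ≤ n) :
    ∃ σ : Fin n → Fin k, Function.Surjective σ :=
  ⟨fun j => ⟨min j (k - 1), by omega⟩, fun i => ⟨⟨i, by omega⟩, Fin.ext (by simp; omega)⟩⟩

end IsothermicNet

theorem theorem1 (k n : ℕ) (hk : 2 ≤ k) (hkn : k ≤ n) :
    (∃ p : (Fin k → ℤ) → IsothermicNet.E n,
      IsothermicNet.IsDiscreteIsothermicTorus p ∧
      IsothermicNet.IsFull (Set.range p)) ∧
    (∃ f : ℝ → (Fin (k - 1) → ℤ) → IsothermicNet.E n,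
      IsothermicNet.IsSemiDiscreteIsothermicTorus f ∧
      IsothermicNet.IsFull {y | ∃ t x, f t x = y}) := by
  constructor
  · obtain ⟨σ, hσ⟩ := IsothermicNet.exists_surjective_fin (by omega) hkn
    refine ⟨IsothermicNet.momentTorus σ,
      ⟨IsothermicNet.isDiscreteIsothermicNet_comp_momentTorus hσ LinearIsometry.id,
        _, IsothermicNet.isDiscreteClosed_momentTorus hσ⟩, ?_⟩
    exact IsothermicNet.isFull_of_inner_sub_eq_zero fun v hv =>
      IsothermicNet.eq_zero_of_inner_momentTorus_sub σ fun x x' => hv _ ⟨x, rfl⟩ _ ⟨x', rfl⟩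
  · obtain ⟨m, rfl⟩ : ∃ m, n = m + 2 := ⟨n - 2, by omega⟩
    obtain ⟨σ, hσ⟩ := IsothermicNet.exists_surjective_fin (k := k - 1) (n := m + 1)
      (by omega) (by omega)
    exact ⟨fun t x => IsothermicNet.rotate t (IsothermicNet.momentTorus σ x),
      IsothermicNet.isSemiDiscreteIsothermicTorus_rotate hσ, IsothermicNet.isFull_rotate⟩
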